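/- Conventions. A category $\mathbb E$ is \emph{regular} if it is finitely complete, regular epimorphisms are stable under pullback, and every kernel pair has a coequalizer; it is \emph{exact} if, moreover, every internal equivalence relation in $\mathbb E$ is effective, i.e. is the kernel pair of some morphism. A category is \emph{Mal'tsev} if it is finitely complete and every internal reflexive relation in it is an equivalence relation. Relations from $X$ to $Y$ are regarded as subobjects $\langle r_0,r_1\rangle\colon R\rightarrowtail X\times Y$. For relations $R\rightarrowtail X\times Y$ and $S\rightarrowtail Y\times Z$ in a regular category, $S\circ R\rightarrowtail X\times Z$ is the mono part of the (regular epi)-mono factorization of $\langle r_0\pi_0,s_1\pi_1\rangle\colon R\times_Y S\to X\times Z$, where $R\times_Y S$ is the pullback of $r_1$ and $s_0$, with projections $\pi_0,\pi_1$. For equivalence relations $R,S$ on $X$: $R\wedge S$ is their intersection as subobjects of $X\times X$; $\Delta_X$ is the diagonal of $X\times X$; $\nabla_X=X\times X$ is the largest equivalence relation on $X$; and $R\vee S=\nabla_X$ means that $\nabla_X$ is the supremum of $R$ and $S$ among the equivalence relations on $X$ (ordered by inclusion of subobjects). In an exact category, $q_R\colon X\to X/R$ denotes the coequalizer of $r_0,r_1\colon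 R\rightrightarrows X$. Theorem. Let $\mathbb E$ be an exact category. (1) Let $R$ and $S$ be equivalence relations on an object $X$ of $\mathbb E$ such that $R\wedge S=\Delta_X$, $R\circ S=S\circ R$ and $R\vee S=\nabla_X$. Then the canonical morphism $\langle q_R,q_S\rangle\colon X\to X/R\times X/S$ is an isomorphism; in particular $X\cong X/R\times X/S$. (2) Suppose that $\mathbb E$ is moreover a Mal'tsev category, and let $R$ and $S$ be equivalence relations on an object $X$ such that $R\wedge S=\Delta_X$ and $R\vee S=\nabla_X$. Then the canonical morphism $\langle q_R,q_S\rangle\colon X\to X/R\times X/S$ is an isomorphism. -/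

import Mathlib

open CategoryTheory CategoryTheory.Limits

universe v u

namespace DirectProduct

/-- A category is *exact* (in the sense of Barr) when it is regular and every internal equivalence
relation in it is effective, that is, the kernel pair of some morphism. -/
class BarrExact (C : Type u) [Category.{v} C] : Prop extends Regular C where
  effective : ∀ {R X : C} (r₀ r₁ : R ⟶ X), IsEquivalenceRelation r₀ r₁ →
    ∃ (Y : C) (f : X ⟶ Y), IsKernelPair f r₀ r₁

/-- A category is a *Mal'tsev category* when it is finitely complete and every internal reflexive
relation in it is an equivalence relation. -/
class Maltsev (C : Type u) [Category.{v} C] : Prop extends HasFiniteLimits C where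
  equivalence_of_reflexive : ∀ {R X : C} (r₀ r₁ : R ⟶ X),
    Nonempty (ReflexiveRelation r₀ r₁) → IsEquivalenceRelation r₀ r₁

section Relations

variable {C : Type u} [Category.{v} C] [HasFiniteLimits C]

/-- A relation from `X` to `Y` is a subobject of `X ⨯ Y`. -/
abbrev Relation (X Y : C) := Subobject (X ⨯ Y)

/-- The first projection `r₀` of a relation. -/
noncomputable abbrev Relation.p₀ {X Y : C} (R : Relation X Y) : (R : C) ⟶ X :=
  Subobject.arrow R ≫ prod.fst

/-- The second projection `r₁` of a relation. -/
noncomputable abbrev Relation.p₁ {X Y : C} (R : Relation X Y) : (R : C) ⟶ Y :=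
  Subobject.arrow R ≫ prod.snd

/-- The discrete relation `Δ_X`: the diagonal subobject of `X ⨯ X`. -/
noncomputable def discreteRel (X : C) : Relation X X := Subobject.mk (diag X)

/-- The equivalence relations on `X`, ordered by inclusion of subobjects of `X ⨯ X`. -/
abbrev EquivRel (X : C) := {R : Relation X X // IsEquivalenceRelation R.p₀ R.p₁}

theorem isKernelPair_top (X : C) :
    IsKernelPair (terminal.from X) (Relation.p₀ (⊤ : Relation X X))
      (Relation.p₁ (⊤ : Relation X X)) :=
  IsPullback.of_iso (IsPullback.of_is_product' (prodIsProd X X) terminalIsTerminal)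
    (asIso (Subobject.arrow (⊤ : Relation X X))).symm (Iso.refl X) (Iso.refl X) (Iso.refl _)
    (by simp [Relation.p₀]) (by simp [Relation.p₁])
    (Subsingleton.elim _ _) (Subsingleton.elim _ _)

/-- The indiscrete (largest) equivalence relation `∇_X`: all of `X ⨯ X`. -/
noncomputable def indiscrete (X : C) : EquivRel X :=
  ⟨⊤, (IsKernelPair.equivalenceRelation (terminal.from X) _ _
    (pullbackIsPullback _ _) (isKernelPair_top X)).isEquivalenceRelation⟩

end Relations

/-- The composite `S ∘ R` of a relation `R` from `X` to `Y` and a relation `S` from `Y` to `Z` in a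
regular category: the mono part of the (regular epi)-mono factorization of
`⟨r₀ π₀, s₁ π₁⟩ : R ×_Y S ⟶ X ⨯ Z`. -/
noncomputable def comp {C : Type u} [Category.{v} C] [Regular C] {X Y Z : C}
    (S : Relation Y Z) (R : Relation X Y) : Relation X Z :=
  Subobject.mk (Regular.strongEpiMonoFactorisation
    (prod.lift (pullback.fst R.p₁ S.p₀ ≫ R.p₀) (pullback.snd R.p₁ S.p₀ ≫ S.p₁))).m

section Quotients

variable {C : Type u} [Category.{v} C] [BarrExact C] {X : C}

theorem hasCoequalizer_of_equivRel (R : EquivRel X) : HasCoequalizer R.1.p₀ R.1.p₁ := by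
  obtain ⟨Y, f, h⟩ := BarrExact.effective _ _ R.2
  exact Regular.hasCoequalizer_of_isKernelPair h

attribute [local instance] hasCoequalizer_of_equivRel

/-- The quotient `X/R` of `X` by an equivalence relation `R`: the coequalizer of `r₀` and `r₁`. -/
noncomputable def quotient (R : EquivRel X) : C := coequalizer R.1.p₀ R.1.p₁

/-- The quotient map `q_R : X ⟶ X/R`. -/
noncomputable def quotientMap (R : EquivRel X) : X ⟶ quotient R := coequalizer.π R.1.p₀ R.1.p₁

end Quotients

end DirectProduct

namespace DirectProduct

open Subobject

attribute [local simp] prod.lift_fst prod.lift_snd prod.lift_fst_assoc prod.lift_snd_assoc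

/-! Relations are handled by generalized elements: `P.Factors (prod.lift a b)` reads "a P b", and
witnesses for composites exist after passing to a cover. The map ⟨q_R, q_S⟩ is mono because its
kernel pair is R ∧ S = Δ. It is strong epi once S ∘ R = ∇: locally any (x, y) admits b with x R b S
y, and b is sent to (q_R x, q_S y). If S ∘ R is an equivalence relation, it is an upper bound of R
and S, hence equals ∇. Commutation or the Mal'tsev axiom serves only to make S ∘ R an equivalence
relation. -/

theorem factors_of_strongEpi_comp {C : Type u} [Category.{v} C] {Y T T' : C} {P : Subobject Y}
    (e : T' ⟶ T) [StrongEpi e] {f : T ⟶ Y} (h : P.Factors (e ≫ f)) : P.Factors f := by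
  have sq : CommSq (P.factorThru _ h) e P.arrow f := ⟨by simp⟩
  exact (factors_iff _ _).2 ⟨sq.lift, sq.fac_right⟩

/-! ### Calculus of generalized elements -/

section Relations

variable {C : Type u} [Category.{v} C] [HasFiniteLimits C] {X : C}

theorem factors_lift_comp {T T' Y : C} {P : Relation X Y} {a : T ⟶ X} {b : T ⟶ Y} (e : T' ⟶ T)
    (h : P.Factors (prod.lift a b)) : P.Factors (prod.lift (e ≫ a) (e ≫ b)) := by
  rw [← prod.comp_lift]
  exact factors_of_factors_right e h

theorem lift_projections {Y : C} (P : Relation X Y) : prod.lift P.p₀ P.p₁ = P.arrow := by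
  ext <;> simp

theorem factors_projections {Y : C} (P : Relation X Y) : P.Factors (prod.lift P.p₀ P.p₁) := by
  rw [lift_projections]
  exact P.factors_self

theorem jointlyMono_projections {Y : C} (P : Relation X Y) : JointlyMono₂ P.p₀ P.p₁ where
  right_cancellation T f g h₀ h₁ := by
    rw [← cancel_mono P.arrow]
    ext
    · simpa using h₀
    · simpa using h₁

theorem factorThru_p₀ {T Y : C} {P : Relation X Y} {a : T ⟶ X} {b : T ⟶ Y}
    (h : P.Factors (prod.lift a b)) : P.factorThru _ h ≫ P.p₀ = a := by simp

theorem factorThru_p₁ {T Y : C} {P : Relation X Y} {a : T ⟶ X} {b : T ⟶ Y}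
    (h : P.Factors (prod.lift a b)) : P.factorThru _ h ≫ P.p₁ = b := by simp

theorem nonempty_reflexiveRelation {P : Relation X X} (h : P.Factors (prod.lift (𝟙 X) (𝟙 X))) :
    Nonempty (ReflexiveRelation P.p₀ P.p₁) :=
  ⟨{ toJointlyMono₂ := jointlyMono_projections P
     r := P.factorThru _ h
     reflexivity₁ := factorThru_p₀ _
     reflexivity₂ := factorThru_p₁ _ }⟩

/-- A relation that is reflexive, symmetric and transitive on generalized elements is an internal
equivalence relation. -/
theorem isEquivalenceRelation_of_factors {P : Relation X X}
    (hr : P.Factors (prod.lift (𝟙 X) (𝟙 X)))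
    (hs : ∀ {T : C} (a b : T ⟶ X), P.Factors (prod.lift a b) → P.Factors (prod.lift b a))
    (ht : ∀ {T : C} (a b c : T ⟶ X), P.Factors (prod.lift a b) → P.Factors (prod.lift b c) →
      P.Factors (prod.lift a c)) :
    IsEquivalenceRelation P.p₀ P.p₁ := by
  have hP := factors_projections P
  have h₁ := factors_lift_comp (pullback.fst P.p₁ P.p₀) hP
  have h₂ := factors_lift_comp (pullback.snd P.p₁ P.p₀) hP
  -- Makes the middle elements of the two related pairs literally equal.
  rw [← pullback.condition] at h₂
  have h₃ := ht _ _ _ h₁ h₂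
  exact ⟨⟨{
    toJointlyMono₂ := jointlyMono_projections P
    r := P.factorThru _ hr
    reflexivity₁ := factorThru_p₀ _
    reflexivity₂ := factorThru_p₁ _
    s := P.factorThru _ (hs _ _ hP)
    symmetry₁ := factorThru_p₀ _
    symmetry₂ := factorThru_p₁ _
    c := PullbackCone.mk _ _ (pullback.condition (f := P.p₁) (g := P.p₀))
    isLimit := pullbackIsPullback _ _
    t := P.factorThru _ h₃
    transitivity₁ := factorThru_p₀ h₃
    transitivity₂ := factorThru_p₁ h₃ }⟩⟩

theorem factors_of_isKernelPair {Y T : C} {P : Relation X X} {f : X ⟶ Y}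
    (h : IsKernelPair f P.p₀ P.p₁) (a b : T ⟶ X) :
    P.Factors (prod.lift a b) ↔ a ≫ f = b ≫ f := by
  constructor
  · intro hab
    calc a ≫ f = (P.factorThru _ hab ≫ P.p₀) ≫ f := by rw [factorThru_p₀]
      _ = (P.factorThru _ hab ≫ P.p₁) ≫ f := by
        simpa only [Category.assoc] using congrArg (P.factorThru _ hab ≫ ·) h.w
      _ = b ≫ f := by rw [factorThru_p₁]
  · intro w
    refine (factors_iff _ _).2 ⟨h.lift a b w, ?_⟩
    change h.lift a b w ≫ P.arrow = _
    ext <;> simp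

theorem factors_discreteRel {T : C} {a b : T ⟶ X}
    (h : (discreteRel X).Factors (prod.lift a b)) : a = b := by
  obtain ⟨g, hg⟩ : ∃ g, g ≫ diag X = prod.lift a b :=
    (mk_factors_iff (diag X) _).1 h
  have ha : g = a := by simpa using congrArg (· ≫ prod.fst) hg
  have hb : g = b := by simpa using congrArg (· ≫ prod.snd) hg
  exact ha.symm.trans hb

end Relations

/-! ### Images, composites and covers -/

section Regular

variable {C : Type u} [Category.{v} C] [Regular C]

/-- The cover is the pullback of `q`, by stability of regular epis; conversely, membership in a
subobject descends along strong epis. -/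
theorem factors_mk_iff_of_fac {W I Y T : C} {f : W ⟶ Y} {q : W ⟶ I} {m : I ⟶ Y} [IsRegularEpi q]
    [Mono m] (hfac : q ≫ m = f) (y : T ⟶ Y) :
    (Subobject.mk m).Factors y ↔
      ∃ (T' : C) (e : T' ⟶ T) (g : T' ⟶ W), StrongEpi e ∧ g ≫ f = e ≫ y := by
  constructor
  · intro h
    obtain ⟨k, rfl⟩ : ∃ k, k ≫ m = y := (mk_factors_iff _ _).1 h
    refine ⟨_, pullback.snd q k, pullback.fst q k, inferInstance, ?_⟩
    rw [← hfac, pullback.condition_assoc]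
  · rintro ⟨T', e, g, _, w⟩
    refine factors_of_strongEpi_comp e ((mk_factors_iff _ _).2 ⟨g ≫ q, ?_⟩)
    change (g ≫ q) ≫ m = _
    rw [Category.assoc, hfac, w]

/-- A generalized element belongs to the image of `f` if and only if it lifts along `f` after passing
to a cover. -/
theorem factors_image_iff {W Y T : C} (f : W ⟶ Y) (y : T ⟶ Y) :
    (Subobject.mk (Regular.strongEpiMonoFactorisation f).m).Factors y ↔
      ∃ (T' : C) (e : T' ⟶ T) (g : T' ⟶ W), StrongEpi e ∧ g ≫ f = e ≫ y :=
  factors_mk_iff_of_fac (Regular.strongEpiMonoFactorisation f).fac y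

/-- Two generalized elements are related by a composite relation if and only if they are so through
an intermediate generalized element after passing to a cover. -/
theorem factors_comp_iff {X Y Z T : C} (S : Relation Y Z) (R : Relation X Y) (a : T ⟶ X)
    (c : T ⟶ Z) :
    (comp S R).Factors (prod.lift a c) ↔
      ∃ (T' : C) (e : T' ⟶ T) (b : T' ⟶ Y), StrongEpi e ∧ R.Factors (prod.lift (e ≫ a) b) ∧
        S.Factors (prod.lift b (e ≫ c)) := by
  let f := prod.lift (pullback.fst R.p₁ S.p₀ ≫ R.p₀) (pullback.snd R.p₁ S.p₀ ≫ S.p₁)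
  refine (factors_image_iff f _).trans ⟨?_, ?_⟩
  · rintro ⟨T', e, g, _, w⟩
    have w₀ : g ≫ pullback.fst R.p₁ S.p₀ ≫ R.p₀ = e ≫ a := by
      simpa [f] using congrArg (· ≫ prod.fst) w
    have w₁ : g ≫ pullback.snd R.p₁ S.p₀ ≫ S.p₁ = e ≫ c := by
      simpa [f] using congrArg (· ≫ prod.snd) w
    refine ⟨T', e, g ≫ pullback.fst R.p₁ S.p₀ ≫ R.p₁, inferInstance, ?_, ?_⟩
    · rw [← w₀]
      exact factors_lift_comp _ (factors_lift_comp _ (factors_projections R))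
    · rw [← w₁, pullback.condition]
      exact factors_lift_comp _ (factors_lift_comp _ (factors_projections S))
  · rintro ⟨T', e, b, _, hR, hS⟩
    refine ⟨T', e, pullback.lift (R.factorThru _ hR) (S.factorThru _ hS) (by simp),
      inferInstance, ?_⟩
    apply prod.hom_ext <;> simp [f, pullback.lift_fst_assoc, pullback.lift_snd_assoc]

theorem factors_comp {X Y Z T : C} {S : Relation Y Z} {R : Relation X Y} {a : T ⟶ X} {b : T ⟶ Y}
    {c : T ⟶ Z} (hR : R.Factors (prod.lift a b)) (hS : S.Factors (prod.lift b c)) :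
    (comp S R).Factors (prod.lift a c) :=
  (factors_comp_iff _ _ _ _).2 ⟨T, 𝟙 T, b, inferInstance, by simpa using hR, by simpa using hS⟩

/-- f × g is (f × 1) followed by (1 × g), base changes of f and g along projections. -/
theorem strongEpi_prod_map {X Y Z W : C} (f : X ⟶ Y) (g : Z ⟶ W) [IsRegularEpi f]
    [IsRegularEpi g] : StrongEpi (prod.map f g) := by
  have hf : IsPullback (prod.fst : X ⨯ Z ⟶ X) (prod.map f (𝟙 Z)) f prod.fst :=
    IsPullback.of_isLimit' ⟨by simp⟩ (PullbackCone.IsLimit.mk _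
      (fun s => prod.lift s.fst (s.snd ≫ prod.snd)) (fun s => by simp)
      (fun s => by ext <;> simp [s.condition])
      (fun s m h₁ h₂ => by ext <;> simp [← h₁, ← h₂]))
  have hg : IsPullback (prod.snd : Y ⨯ Z ⟶ Z) (prod.map (𝟙 Y) g) g prod.snd :=
    IsPullback.of_isLimit' ⟨by simp⟩ (PullbackCone.IsLimit.mk _
      (fun s => prod.lift (s.snd ≫ prod.fst) s.fst) (fun s => by simp)
      (fun s => by ext <;> simp [s.condition])
      (fun s m h₁ h₂ => by ext <;> simp [← h₁, ← h₂]))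
  have h₁ : IsRegularEpi (prod.map f (𝟙 Z)) :=
    Regular.regularEpiIsStableUnderBaseChange.of_isPullback hf ‹_›
  have h₂ : IsRegularEpi (prod.map (𝟙 Y) g) :=
    Regular.regularEpiIsStableUnderBaseChange.of_isPullback hg ‹_›
  have : prod.map f g = prod.map f (𝟙 Z) ≫ prod.map (𝟙 Y) g := by simp
  rw [this]
  exact strongEpi_comp _ _

end Regular

/-! ### Quotients and the decomposition -/

section Quotients

variable {C : Type u} [Category.{v} C] [BarrExact C] {X : C}

attribute [local instance] hasCoequalizer_of_equivRel

instance (R : EquivRel X) : IsRegularEpi (quotientMap R) :=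
  inferInstanceAs (IsRegularEpi (coequalizer.π R.1.p₀ R.1.p₁))

/-- Exactness makes R the kernel pair of some f; as f factors through q_R, which already coequalizes
R, R is also the kernel pair of q_R. -/
theorem isKernelPair_quotientMap (R : EquivRel X) :
    IsKernelPair (quotientMap R) R.1.p₀ R.1.p₁ := by
  obtain ⟨Y, f, h⟩ := BarrExact.effective _ _ R.2
  have hf : quotientMap R ≫ coequalizer.desc f h.w = f := coequalizer.π_desc _ _
  rw [← hf] at h
  exact h.cancel_right (coequalizer.condition _ _)

theorem equivRel_factors_iff (R : EquivRel X) {T : C} (a b : T ⟶ X) :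
    R.1.Factors (prod.lift a b) ↔ a ≫ quotientMap R = b ≫ quotientMap R :=
  factors_of_isKernelPair (isKernelPair_quotientMap R) a b

theorem equivRel_refl (R : EquivRel X) {T : C} (a : T ⟶ X) : R.1.Factors (prod.lift a a) :=
  (equivRel_factors_iff R a a).2 rfl

theorem equivRel_symm (R : EquivRel X) {T : C} {a b : T ⟶ X} (h : R.1.Factors (prod.lift a b)) :
    R.1.Factors (prod.lift b a) :=
  (equivRel_factors_iff R b a).2 ((equivRel_factors_iff R a b).1 h).symm

theorem equivRel_trans (R : EquivRel X) {T : C} {a b c : T ⟶ X}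
    (h : R.1.Factors (prod.lift a b)) (h' : R.1.Factors (prod.lift b c)) :
    R.1.Factors (prod.lift a c) :=
  (equivRel_factors_iff R a c).2
    (((equivRel_factors_iff R a b).1 h).trans ((equivRel_factors_iff R b c).1 h'))

theorem le_comp_left (R S : EquivRel X) : S.1 ≤ comp S.1 R.1 := by
  refine le_of_factors ?_
  rw [← lift_projections]
  exact factors_comp (equivRel_refl R _) (factors_projections S.1)

theorem le_comp_right (R S : EquivRel X) : R.1 ≤ comp S.1 R.1 := by
  refine le_of_factors ?_
  rw [← lift_projections]
  exact factors_comp (factors_projections R.1) (equivRel_refl S _)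

/-- The composite of two commuting equivalence relations is an equivalence relation. -/
theorem isEquivalenceRelation_comp {R S : EquivRel X} (h : comp R.1 S.1 = comp S.1 R.1) :
    IsEquivalenceRelation (comp S.1 R.1).p₀ (comp S.1 R.1).p₁ := by
  refine isEquivalenceRelation_of_factors
    (factors_comp (equivRel_refl R _) (equivRel_refl S _)) ?_ ?_
  · intro T a c hac
    obtain ⟨T', e, b, _, hR, hS⟩ := (factors_comp_iff _ _ _ _).1 hac
    rw [← h]
    exact (factors_comp_iff _ _ _ _).2
      ⟨T', e, b, inferInstance, equivRel_symm S hS, equivRel_symm R hR⟩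
  · intro T a c d hac hcd
    obtain ⟨T₁, e₁, b₁, _, hR₁, hS₁⟩ := (factors_comp_iff _ _ _ _).1 hac
    obtain ⟨T₂, e₂, b₂, _, hR₂, hS₂⟩ :=
      (factors_comp_iff _ _ _ _).1 (factors_lift_comp e₁ hcd)
    -- In the path a R b₁ S c R b₂ S d, commutation turns the inner S, R into R, S, so transitivity
    -- of R and of S applies.
    have hb : (comp R.1 S.1).Factors (prod.lift (e₂ ≫ b₁) b₂) :=
      factors_comp (factors_lift_comp e₂ hS₁) hR₂
    rw [h] at hb
    obtain ⟨T₃, e₃, b₃, _, hR₃, hS₃⟩ := (factors_comp_iff _ _ _ _).1 hb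
    have hR := equivRel_trans R (factors_lift_comp e₃ (factors_lift_comp e₂ hR₁)) hR₃
    have hS := equivRel_trans S hS₃ (factors_lift_comp e₃ hS₂)
    have : StrongEpi (e₂ ≫ e₁) := strongEpi_comp _ _
    have : StrongEpi (e₃ ≫ e₂ ≫ e₁) := strongEpi_comp _ _
    exact (factors_comp_iff _ _ _ _).2
      ⟨T₃, e₃ ≫ e₂ ≫ e₁, b₃, inferInstance, by simpa using hR, by simpa using hS⟩

theorem mono_lift_quotientMap {R S : EquivRel X} (h : R.1 ⊓ S.1 = discreteRel X) :
    Mono (prod.lift (quotientMap R) (quotientMap S)) where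
  right_cancellation a b w := by
    have hR : a ≫ quotientMap R = b ≫ quotientMap R := by
      simpa using congrArg (· ≫ prod.fst) w
    have hS : a ≫ quotientMap S = b ≫ quotientMap S := by
      simpa using congrArg (· ≫ prod.snd) w
    refine factors_discreteRel ?_
    rw [← h]
    exact (inf_factors _).2 ⟨(equivRel_factors_iff R a b).2 hR, (equivRel_factors_iff S a b).2 hS⟩

theorem strongEpi_lift_quotientMap {R S : EquivRel X} (h : comp S.1 R.1 = ⊤) :
    StrongEpi (prod.lift (quotientMap R) (quotientMap S)) := by
  have ht : (comp S.1 R.1).Factors (prod.lift (prod.fst : X ⨯ X ⟶ X) prod.snd) := by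
    rw [h]
    exact top_factors _
  obtain ⟨T, e, b, _, hR, hS⟩ := (factors_comp_iff _ _ _ _).1 ht
  rw [equivRel_factors_iff] at hR hS
  -- For the generic pair, b is R-related to the first coordinate and S-related to the second.
  have w : b ≫ prod.lift (quotientMap R) (quotientMap S) =
      e ≫ prod.map (quotientMap R) (quotientMap S) := by
    ext
    · simpa using hR.symm
    · simpa using hS
  have := strongEpi_prod_map (quotientMap R) (quotientMap S)
  have : StrongEpi (b ≫ prod.lift (quotientMap R) (quotientMap S)) := by
    rw [w]
    exact strongEpi_comp _ _
  exact strongEpi_of_strongEpi b _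

theorem exists_iso_prod_quotient {R S : EquivRel X} (hinf : R.1 ⊓ S.1 = discreteRel X)
    (hsup : IsLUB {R, S} (indiscrete X))
    (hcomp : IsEquivalenceRelation (comp S.1 R.1).p₀ (comp S.1 R.1).p₁) :
    ∃ e : X ≅ quotient R ⨯ quotient S, e.hom = prod.lift (quotientMap R) (quotientMap S) := by
  have hub : (⟨comp S.1 R.1, hcomp⟩ : EquivRel X) ∈ upperBounds {R, S} := by
    rintro Q (rfl | rfl)
    · exact le_comp_right _ _
    · exact le_comp_left _ _
  have htop : comp S.1 R.1 = ⊤ := top_le_iff.1 (hsup.2 hub)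
  have := mono_lift_quotientMap hinf
  have := strongEpi_lift_quotientMap htop
  have := isIso_of_mono_of_strongEpi (prod.lift (quotientMap R) (quotientMap S))
  exact ⟨asIso (prod.lift (quotientMap R) (quotientMap S)), rfl⟩

end Quotients

end DirectProduct

theorem mainTheorem9 {C : Type u} [Category.{v} C] [DirectProduct.BarrExact C] :
    (∀ (X : C) (R S : DirectProduct.EquivRel X),
      R.1 ⊓ S.1 = DirectProduct.discreteRel X →
      DirectProduct.comp R.1 S.1 = DirectProduct.comp S.1 R.1 →
      IsLUB {R, S} (DirectProduct.indiscrete X) →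
      ∃ e : X ≅ DirectProduct.quotient R ⨯ DirectProduct.quotient S,
        e.hom = prod.lift (DirectProduct.quotientMap R) (DirectProduct.quotientMap S)) ∧
    (DirectProduct.Maltsev C → ∀ (X : C) (R S : DirectProduct.EquivRel X),
      R.1 ⊓ S.1 = DirectProduct.discreteRel X →
      IsLUB {R, S} (DirectProduct.indiscrete X) →
      ∃ e : X ≅ DirectProduct.quotient R ⨯ DirectProduct.quotient S,
        e.hom = prod.lift (DirectProduct.quotientMap R) (DirectProduct.quotientMap S)) := by
  refine ⟨fun X R S hinf hcomm hsup => ?_, fun hM X R S hinf hsup => ?_⟩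
  · exact DirectProduct.exists_iso_prod_quotient hinf hsup
      (DirectProduct.isEquivalenceRelation_comp hcomm)
  · exact DirectProduct.exists_iso_prod_quotient hinf hsup
      -- In a Mal'tsev category reflexivity of S ∘ R suffices.
      (hM.equivalence_of_reflexive _ _ (DirectProduct.nonempty_reflexiveRelation
        (DirectProduct.factors_comp (DirectProduct.equivRel_refl R _)
          (DirectProduct.equivRel_refl S _))))
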